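/- Let $n\ge 0$ be an integer. For $b=(b_1,\ldots,b_n)\in\mathbb{R}^n$ let $$g_b=\bigl(x^{2n}+1\bigr)+b_1\bigl(x^{2n-1}+x\bigr)+\cdots+b_{n-1}\bigl(x^{n+1}+x^{n-1}\bigr)+b_nx^n\in\mathbb{R}[x],$$ and let $V_n$ be the set of those $b\in\mathbb{R}^n$ such that all complex roots of $g_b$ lie on the unit circle (for $n=0$ we read $g_b$ as the constant $2$, so that $V_0=\mathbb{R}^0$ is a single point, of volume $1$). Then $V_n$ is Borel measurable, and its volume ($n$-dimensional Lebesgue measure) $v_n$ is given by $$v_n=\frac{2^{n(n+1)}}{n!}\prod_{1\le i<j\le n}\frac{j-i}{j+i}=\frac{2^n}{n!}\prod_{j=1}^n\left(\frac{2j}{2j-1}\right)^{n+1-j}.$$ -/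

import Mathlib

open Polynomial in
/-- The palindromic polynomial
`g_b = (x^{2n} + 1) + b₁ (x^{2n-1} + x) + ⋯ + b_{n-1} (x^{n+1} + x^{n-1}) + b_n x^n`.
The coefficient `b_k` of the text is `b i` with `k = i + 1`. -/
noncomputable def palindromicPoly (n : ℕ) (b : Fin n → ℝ) : ℝ[X] :=
  (X ^ (2 * n) + 1) +
    ∑ i : Fin n,
      if (i : ℕ) + 1 = n then C (b i) * X ^ n
      else C (b i) * (X ^ (2 * n - ((i : ℕ) + 1)) + X ^ ((i : ℕ) + 1))

/-- The region `V_n ⊆ ℝⁿ`: those `b` for which all complex roots of `g_b` lie on the unit circle. -/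
def unitCircleRegion (n : ℕ) : Set (Fin n → ℝ) :=
  {b | ∀ z : ℂ, Polynomial.aeval z (palindromicPoly n b) = 0 → ‖z‖ = 1}

/-! For `n ≠ 0`, write `g_b(z) = z ^ n * p_b(z + z⁻¹)`, where `p_b` is monic of degree `n` and has
coordinates `b` in the basis `1, C₁, C₂, …` with `Cₖ(z + z⁻¹) = z ^ k + z⁻¹ ^ k`. The roots of `g_b`
are all unimodular iff those of `p_b` all lie in `[-2, 2]`. So `V_n` is the image of `[0, 4]ⁿ` under
the map from roots, shifted by `-2`, to coordinates (`unitCircleRegion_eq_image`).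

In any monic basis the Jacobian of this map is the Vandermonde determinant `Δ` up to sign, and the
map is injective on increasing tuples. Hence `v_n = (1/n!) ∫ |Δ|` over the cube
(`volume_image_rootCoords`).

This is a Selberg integral with exponent 1 on `|Δ|`. Integration by parts against `t - L` lowers the
dimension but inserts the weight `∏ xᵢ` (`integral_absVandermonde_succ`). Aomoto's method removes
that weight one variable at a time (`aomoto_recursion`). The resulting ratio of consecutive volumes
is also that of both closed forms. -/

open MeasureTheory Set

/-! ### Cube measure and the absolute Vandermonde determinant -/

/-- The absolute value of the Vandermonde determinant of `x`. -/
noncomputable def absVandermonde {n : ℕ} (x : Fin n → ℝ) : ℝ :=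
  |(Matrix.vandermonde x).det|

/-- Lebesgue measure restricted to the cube `[0, L]ⁿ`, as a product measure. -/
noncomputable def cubeMeasure (L : ℝ) (n : ℕ) : Measure (Fin n → ℝ) :=
  Measure.pi fun _ => volume.restrict (Icc 0 L)

instance (L : ℝ) (n : ℕ) : IsFiniteMeasure (cubeMeasure L n) := by
  unfold cubeMeasure; infer_instance

theorem cubeMeasure_eq_restrict (L : ℝ) (n : ℕ) :
    cubeMeasure L n = volume.restrict (Set.pi univ fun _ => Icc 0 L) := by
  rw [cubeMeasure, ← Measure.restrict_pi_pi, volume_pi]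

theorem Continuous.integrable_cubeMeasure {L : ℝ} {n : ℕ} {F : (Fin n → ℝ) → ℝ}
    (hF : Continuous F) : Integrable F (cubeMeasure L n) := by
  rw [cubeMeasure_eq_restrict]
  exact hF.continuousOn.integrableOn_compact (isCompact_univ_pi fun _ => isCompact_Icc)

theorem measurePreserving_comp_perm {α : Type*} [MeasurableSpace α] (μ : Measure α) [SigmaFinite μ]
    {n : ℕ} (σ : Equiv.Perm (Fin n)) :
    MeasurePreserving (MeasurableEquiv.arrowCongr' σ.symm (MeasurableEquiv.refl α))
      (Measure.pi fun _ : Fin n => μ) (Measure.pi fun _ : Fin n => μ) :=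
  measurePreserving_arrowCongr' (fun _ => μ) (fun _ => μ) σ.symm (MeasurableEquiv.refl α)
    fun _ => MeasurePreserving.id μ

theorem integral_cubeMeasure_comp_perm (L : ℝ) {n : ℕ} (σ : Equiv.Perm (Fin n))
    (F : (Fin n → ℝ) → ℝ) :
    ∫ x, F (x ∘ σ) ∂cubeMeasure L n = ∫ x, F x ∂cubeMeasure L n :=
  (measurePreserving_comp_perm (volume.restrict (Icc (0 : ℝ) L)) σ).integral_comp' F

theorem absVandermonde_nonneg {n : ℕ} (x : Fin n → ℝ) : 0 ≤ absVandermonde x := abs_nonneg _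

theorem absVandermonde_comp_perm {n : ℕ} (σ : Equiv.Perm (Fin n)) (x : Fin n → ℝ) :
    absVandermonde (x ∘ σ) = absVandermonde x := by
  have h : Matrix.vandermonde (x ∘ σ) = (Matrix.vandermonde x).submatrix σ id := by
    ext i j; simp [Matrix.vandermonde_apply]
  rw [absVandermonde, absVandermonde, h, Matrix.det_permute, abs_mul]
  rcases Int.units_eq_one_or (Equiv.Perm.sign σ) with h | h <;> simp [h]

theorem continuous_absVandermonde {n : ℕ} :
    Continuous (absVandermonde : (Fin n → ℝ) → ℝ) := by
  unfold absVandermonde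
  simp only [Matrix.det_vandermonde]
  fun_prop

theorem absVandermonde_succ {n : ℕ} (x : Fin (n + 1) → ℝ) :
    absVandermonde x = (∏ j : Fin n, |x 0 - x j.succ|) * absVandermonde (Fin.tail x) := by
  simp only [absVandermonde, Matrix.det_vandermonde, Fin.prod_univ_succ, Fin.prod_Ioi_zero,
    Fin.prod_Ioi_succ, abs_mul, Finset.abs_prod, Fin.tail]
  simp only [abs_sub_comm (x 0)]

/-! ### Quotients of the Vandermonde and swap antisymmetry -/

/-- The quotient of `absVandermonde x` by `x 0 - x (j + 1)`. -/
noncomputable def vandermondeQuot {n : ℕ} (j : Fin n) (x : Fin (n + 1) → ℝ) : ℝ :=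
  absVandermonde x / (x 0 - x j.succ)

/-- The quotient is a bounded sign times a continuous function, which gives integrability. On the
diagonal, division by zero and the sign of zero both give 0. -/
theorem vandermondeQuot_eq {n : ℕ} (j : Fin n) (x : Fin (n + 1) → ℝ) :
    vandermondeQuot j x = (SignType.sign (x 0 - x j.succ) : ℝ) *
      ((∏ i ∈ Finset.univ.erase j, |x 0 - x i.succ|) * absVandermonde (Fin.tail x)) := by
  rw [vandermondeQuot, absVandermonde_succ, ← Finset.mul_prod_erase _ _ (Finset.mem_univ j)]
  rcases eq_or_ne (x 0 - x j.succ) 0 with h | h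
  · simp [h]
  · rw [div_eq_iff h]
    rw [← sign_mul_self (x 0 - x j.succ)]; ring

theorem sub_mul_vandermondeQuot {n : ℕ} (j : Fin n) (x : Fin (n + 1) → ℝ) :
    (x 0 - x j.succ) * vandermondeQuot j x = absVandermonde x := by
  rw [vandermondeQuot]
  rcases eq_or_ne (x 0 - x j.succ) 0 with h | h
  · rw [absVandermonde_succ, Finset.prod_eq_zero (Finset.mem_univ j) (by simp [h])]; simp
  · field_simp

theorem vandermondeQuot_comp_swap {n : ℕ} (j : Fin n) (x : Fin (n + 1) → ℝ) :
    vandermondeQuot j (x ∘ Equiv.swap 0 j.succ) = -vandermondeQuot j x := by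
  rw [vandermondeQuot, vandermondeQuot, absVandermonde_comp_perm]
  simp only [Function.comp, Equiv.swap_apply_left, Equiv.swap_apply_right]
  rw [← neg_sub, div_neg]

theorem measurable_sign_real : Measurable fun t : ℝ => (SignType.sign t : ℝ) := by
  have : (fun t : ℝ => (SignType.sign t : ℝ)) =
      fun t => if 0 < t then 1 else if t < 0 then -1 else 0 := by
    ext t
    rw [sign_apply]; split_ifs <;> simp
  rw [this]
  exact Measurable.ite measurableSet_Ioi measurable_const
    (Measurable.ite measurableSet_Iio measurable_const measurable_const)

theorem integrable_mul_vandermondeQuot {L : ℝ} {n : ℕ} (j : Fin n) {F : (Fin (n + 1) → ℝ) → ℝ}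
    (hF : Continuous F) :
    Integrable (fun x => F x * vandermondeQuot j x) (cubeMeasure L (n + 1)) := by
  have hc : Continuous fun x : Fin (n + 1) → ℝ => F x *
      ((∏ i ∈ Finset.univ.erase j, |x 0 - x i.succ|) * absVandermonde (Fin.tail x)) := by
    have := (continuous_absVandermonde (n := n)).comp
      (continuous_pi fun i => continuous_apply (i.succ) : Continuous
        (fun (x : Fin (n + 1) → ℝ) => fun i => x i.succ))
    refine hF.mul (Continuous.mul (by fun_prop) this)
  have hm : Measurable fun x : Fin (n + 1) → ℝ => (SignType.sign (x 0 - x j.succ) : ℝ) := by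
    exact measurable_sign_real.comp (by fun_prop)
  refine ((hc.integrable_cubeMeasure (L := L)).bdd_mul (c := 1) hm.aestronglyMeasurable
    (Filter.Eventually.of_forall fun x => ?_)).congr (Filter.Eventually.of_forall fun x => ?_)
  · rcases SignType.trichotomy (SignType.sign (x 0 - x j.succ)) with h | h | h <;> simp [h]
  · simp only [vandermondeQuot_eq]; ring

/-- The quotient is odd under swapping coordinates `0` and `j + 1`, so only the odd part of `F`
contributes; its factor `x 0 - x j.succ` turns the quotient back into `absVandermonde`. -/
theorem integral_mul_vandermondeQuot {L : ℝ} {n : ℕ} (j : Fin n) {F G : (Fin (n + 1) → ℝ) → ℝ}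
    (hF : Continuous F)
    (hG : ∀ x, F x - F (x ∘ Equiv.swap 0 j.succ) = (x 0 - x j.succ) * G x) :
    ∫ x, F x * vandermondeQuot j x ∂cubeMeasure L (n + 1) =
      (∫ x, G x * absVandermonde x ∂cubeMeasure L (n + 1)) / 2 := by
  have h1 := integral_cubeMeasure_comp_perm L (Equiv.swap 0 j.succ)
    fun x => F x * vandermondeQuot j x
  simp only [vandermondeQuot_comp_swap] at h1
  have hF' : Continuous fun x : Fin (n + 1) → ℝ => F (x ∘ Equiv.swap 0 j.succ) :=
    hF.comp (continuous_pi fun i => continuous_apply _)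
  have h2 : ∫ x, G x * absVandermonde x ∂cubeMeasure L (n + 1) =
      ∫ x, F x * vandermondeQuot j x ∂cubeMeasure L (n + 1) +
      ∫ x, F (x ∘ Equiv.swap 0 j.succ) * -vandermondeQuot j x ∂cubeMeasure L (n + 1) := by
    rw [← integral_add (integrable_mul_vandermondeQuot j hF)]
    · refine integral_congr_ae (Filter.Eventually.of_forall fun x => ?_)
      simp only
      rw [← sub_mul_vandermondeQuot j x]
      linear_combination (-vandermondeQuot j x) * hG x
    · simp only [mul_neg]
      exact (integrable_mul_vandermondeQuot j hF').neg
  linarith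

/-! ### Integration by parts in one variable -/

theorem integral_cubeMeasure_succ {L : ℝ} {n : ℕ} {F : (Fin (n + 1) → ℝ) → ℝ}
    (hF : Integrable F (cubeMeasure L (n + 1))) :
    ∫ x, F x ∂cubeMeasure L (n + 1) =
      ∫ y, (∫ t in Icc 0 L, F (Fin.cons t y)) ∂cubeMeasure L n := by
  have hp := (measurePreserving_piFinSuccAbove
    (fun _ : Fin (n + 1) => volume.restrict (Icc (0 : ℝ) L)) 0).symm
  have h1 := hp.integral_comp' F
  have h2 := (hp.integrable_comp_emb (MeasurableEquiv.measurableEmbedding _)).2 hF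
  rw [cubeMeasure, ← h1]
  refine (integral_prod_symm _ h2).trans ?_
  simp [MeasurableEquiv.piFinSuccAbove, cubeMeasure, Fin.insertNthEquiv]

/-- The product of absolute values is continuous and fails to be differentiable only at the finitely
many `y j`, so the fundamental theorem of calculus still applies. -/
theorem integral_deriv_mul_prod_abs_sub {L : ℝ} (hL : 0 ≤ L) {n : ℕ} (y : Fin n → ℝ)
    {φ φ' : ℝ → ℝ} (hφ : ∀ t, HasDerivAt φ (φ' t) t)
    (hi : IntegrableOn (fun t => φ' t * ∏ j, |t - y j| + φ t * ∑ j,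
      (∏ i ∈ Finset.univ.erase j, |t - y i|) * (SignType.sign (t - y j) : ℝ)) (Icc 0 L)) :
    ∫ t in Icc 0 L, (φ' t * ∏ j, |t - y j| + φ t * ∑ j,
      (∏ i ∈ Finset.univ.erase j, |t - y i|) * (SignType.sign (t - y j) : ℝ)) =
      φ L * ∏ j, |L - y j| - φ 0 * ∏ j, |0 - y j| := by
  rw [integral_Icc_eq_integral_Ioc, ← intervalIntegral.integral_of_le hL]
  have hc : Continuous φ := continuous_iff_continuousAt.2 fun t => (hφ t).continuousAt
  refine integral_eq_of_hasDerivAt_off_countable_of_le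
    (fun t => φ t * ∏ j, |t - y j|) _ hL (countable_range y) ?_ ?_ ?_
  · exact Continuous.continuousOn (by fun_prop)
  · rintro t ⟨-, ht⟩
    have : HasDerivAt (fun t => ∏ j, |t - y j|) (∑ j,
      (∏ i ∈ Finset.univ.erase j, |t - y i|) • (SignType.sign (t - y j) : ℝ)) t := by
      refine HasDerivAt.fun_finsetProd fun j _ => ?_
      have h0 : t - y j ≠ 0 := fun h => ht ⟨j, by linarith⟩
      have := (hasDerivAt_abs h0).comp t ((hasDerivAt_id t).sub_const (y j))
      rwa [mul_one] at this
    exact (hφ t).mul this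
  · rw [intervalIntegrable_iff_integrableOn_Icc_of_le hL]
    exact hi

/-- Integration by parts in the first variable against `absVandermonde`. -/
theorem integral_deriv_mul_absVandermonde {L : ℝ} (hL : 0 ≤ L) {n : ℕ}
    {φ φ' : ℝ → ℝ} (hφ : ∀ t, HasDerivAt φ (φ' t) t) (hφ' : Continuous φ')
    {ψ : (Fin n → ℝ) → ℝ} (hψ : Continuous ψ) :
    ∫ x, φ' (x 0) * ψ (Fin.tail x) * absVandermonde x ∂cubeMeasure L (n + 1) +
      ∑ j, ∫ x, φ (x 0) * ψ (Fin.tail x) * vandermondeQuot j x ∂cubeMeasure L (n + 1) =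
    ∫ y, (φ L * ∏ j, |L - y j| - φ 0 * ∏ j, |0 - y j|) * ψ y * absVandermonde y
      ∂cubeMeasure L n := by
  have hc : Continuous φ := continuous_iff_continuousAt.2 fun t => (hφ t).continuousAt
  have ht : Continuous fun x : Fin (n + 1) → ℝ => ψ (Fin.tail x) :=
    hψ.comp (continuous_pi fun i => continuous_apply i.succ)
  have hi1 : Integrable (fun x : Fin (n + 1) → ℝ =>
      φ' (x 0) * ψ (Fin.tail x) * absVandermonde x) (cubeMeasure L (n + 1)) :=
    Continuous.integrable_cubeMeasure
      (((hφ'.comp (continuous_apply 0)).mul ht).mul continuous_absVandermonde)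
  have hi2 : ∀ j : Fin n, Integrable (fun x : Fin (n + 1) → ℝ =>
      φ (x 0) * ψ (Fin.tail x) * vandermondeQuot j x) (cubeMeasure L (n + 1)) := fun j =>
    integrable_mul_vandermondeQuot j ((hc.comp (continuous_apply 0)).mul ht)
  have hi3 := hi1.add (integrable_finsetSum Finset.univ fun j _ => hi2 j)
  rw [← integral_finsetSum _ fun j _ => hi2 j,
    ← integral_add hi1 (integrable_finsetSum _ fun j _ => hi2 j)]
  refine (integral_cubeMeasure_succ hi3).trans ?_
  refine integral_congr_ae (Filter.Eventually.of_forall fun y => ?_)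
  simp only [Pi.add_apply, Fin.cons_zero, Fin.tail_cons]
  have hm : ∀ j, Measurable fun t : ℝ => (SignType.sign (t - y j) : ℝ) := fun j =>
    measurable_sign_real.comp (by fun_prop)
  rw [← integral_deriv_mul_prod_abs_sub hL y hφ, mul_assoc, ← integral_mul_const]
  · refine integral_congr_ae (Filter.Eventually.of_forall fun t => ?_)
    simp only [absVandermonde_succ, vandermondeQuot_eq, Fin.cons_zero, Fin.cons_succ,
      Fin.tail_cons, Finset.mul_sum, Finset.sum_mul, add_mul]
    congr 1
    · ring
    · exact Finset.sum_congr rfl fun j _ => by ring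
  · refine Integrable.add (Continuous.integrableOn_Icc (by fun_prop)) ?_
    simp only [Finset.mul_sum]
    refine integrable_finsetSum _ fun j _ => ?_
    have : IntegrableOn (fun t => φ t * ∏ i ∈ Finset.univ.erase j, |t - y i|) (Icc 0 L) :=
      Continuous.integrableOn_Icc (by fun_prop)
    simp only [← mul_assoc]
    refine this.mul_bdd (c := 1) (hm j).aestronglyMeasurable
      (Filter.Eventually.of_forall fun t => ?_)
    rcases SignType.trichotomy (SignType.sign (t - y j)) with h | h | h <;> simp [h]

/-! ### Aomoto's recursion -/

theorem prod_comp_swap_succ {n : ℕ} {T : Finset (Fin n)} {j : Fin n} (hj : j ∉ T)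
    (x : Fin (n + 1) → ℝ) :
    ∏ i ∈ T, x (Equiv.swap 0 j.succ i.succ) = ∏ i ∈ T, x i.succ :=
  Finset.prod_congr rfl fun i hi => by
    have hij : i.succ ≠ j.succ := fun h => hj (Fin.succ_injective _ h ▸ hi)
    rw [Equiv.swap_apply_of_ne_of_ne (Fin.succ_ne_zero i) hij]

theorem integral_prod_mul_absVandermonde_insert {L : ℝ} {n : ℕ} {T : Finset (Fin n)} {a : Fin n}
    (ha : a ∉ T) :
    ∫ x, (∏ i ∈ insert a T, x i.succ) * absVandermonde x ∂cubeMeasure L (n + 1) =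
      ∫ x, (x 0 * ∏ i ∈ T, x i.succ) * absVandermonde x ∂cubeMeasure L (n + 1) := by
  rw [← integral_cubeMeasure_comp_perm L (Equiv.swap 0 a.succ)]
  refine integral_congr_ae (Filter.Eventually.of_forall fun x => ?_)
  simp only [absVandermonde_comp_perm, Finset.prod_insert ha, Function.comp,
    Equiv.swap_apply_right]
  rw [prod_comp_swap_succ ha]

/-- Aomoto's recursion, with `x 0` as the distinguished variable. -/
theorem aomoto_recursion {L : ℝ} (hL : 0 ≤ L) {n : ℕ} (T : Finset (Fin n)) :
    (∫ x, (x 0 * ∏ i ∈ T, x i.succ) * absVandermonde x ∂cubeMeasure L (n + 1)) *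
        (2 * n - T.card + 4) =
      L * (∫ x, (∏ i ∈ T, x i.succ) * absVandermonde x ∂cubeMeasure L (n + 1)) *
        (n - T.card + 2) := by
  set E₀ := ∫ x, (x 0 * ∏ i ∈ T, x i.succ) * absVandermonde x ∂cubeMeasure L (n + 1) with hE₀
  set E₁ := ∫ x, (∏ i ∈ T, x i.succ) * absVandermonde x ∂cubeMeasure L (n + 1) with hE₁
  have hi₀ : Integrable (fun x : Fin (n + 1) → ℝ => (x 0 * ∏ i ∈ T, x i.succ) * absVandermonde x)
      (cubeMeasure L (n + 1)) :=
    Continuous.integrable_cubeMeasure (Continuous.mul (by fun_prop) continuous_absVandermonde)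
  have hi₁ : Integrable (fun x : Fin (n + 1) → ℝ => (∏ i ∈ T, x i.succ) * absVandermonde x)
      (cubeMeasure L (n + 1)) :=
    Continuous.integrable_cubeMeasure (Continuous.mul (by fun_prop) continuous_absVandermonde)
  -- `t * (L - t)` vanishes at both ends of `[0, L]`, so there is no boundary term.
  have ibp := integral_deriv_mul_absVandermonde hL (n := n) (φ := fun t => t * L - t ^ 2)
    (φ' := fun t => L - 2 * t) (ψ := fun y => ∏ i ∈ T, y i)
    (fun t => (((hasDerivAt_id t).mul_const L).sub (hasDerivAt_pow 2 t)).congr_deriv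
      (by simp))
    (by fun_prop) (by fun_prop)
  have hrhs : ∀ y : Fin n → ℝ, ((L * L - L ^ 2) * ∏ j, |L - y j| -
      (0 * L - 0 ^ 2) * ∏ j, |0 - y j|) * (∏ i ∈ T, y i) * absVandermonde y = 0 := by
    intro y; ring
  simp only [hrhs, integral_zero, Fin.tail] at ibp
  have hfirst : ∫ x, (L - 2 * x 0) * (∏ i ∈ T, x i.succ) * absVandermonde x
      ∂cubeMeasure L (n + 1) = L * E₁ - 2 * E₀ := by
    rw [hE₀, hE₁, ← integral_const_mul, ← integral_const_mul,
      ← integral_sub (hi₁.const_mul _) (hi₀.const_mul _)]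
    exact integral_congr_ae (Filter.Eventually.of_forall fun x => by simp only; ring)
  -- With `ψ` the weight over `T`, antisymmetrize `(x 0 * L - x 0 ^ 2) * ψ` in `x 0` and `x j.succ`.
  -- If `j ∈ T`, the terms in `L` cancel; otherwise the factor left is `L - x 0 - x j.succ`, and by
  -- symmetry both variables contribute `E₀`.
  have hterm : ∀ j : Fin n, ∫ x, (x 0 * L - x 0 ^ 2) * (∏ i ∈ T, x i.succ) * vandermondeQuot j x
      ∂cubeMeasure L (n + 1) = if j ∈ T then -(E₀ / 2) else L * E₁ / 2 - E₀ := by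
    intro j
    split_ifs with hj
    · rw [integral_mul_vandermondeQuot j (G := fun x => -(x 0 * ∏ i ∈ T, x i.succ)) (by fun_prop)]
      · simp only [neg_mul, integral_neg]
        rw [← hE₀, neg_div]
      · intro x
        simp only [← Finset.mul_prod_erase T _ hj, Function.comp, Equiv.swap_apply_left,
          Equiv.swap_apply_right]
        rw [prod_comp_swap_succ (Finset.notMem_erase j T)]
        ring
    · have hsym : ∫ x, (x j.succ * ∏ i ∈ T, x i.succ) * absVandermonde x ∂cubeMeasure L (n + 1)
          = E₀ := by
        rw [hE₀, ← integral_prod_mul_absVandermonde_insert hj]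
        simp only [Finset.prod_insert hj]
      rw [integral_mul_vandermondeQuot j
        (G := fun x => (L - x 0 - x j.succ) * (∏ i ∈ T, x i.succ)) (by fun_prop)]
      · have hij : Integrable (fun x : Fin (n + 1) → ℝ =>
            (x j.succ * ∏ i ∈ T, x i.succ) * absVandermonde x) (cubeMeasure L (n + 1)) :=
          Continuous.integrable_cubeMeasure
            (Continuous.mul (by fun_prop) continuous_absVandermonde)
        have : ∫ x, (L - x 0 - x j.succ) * (∏ i ∈ T, x i.succ) * absVandermonde x
            ∂cubeMeasure L (n + 1) = L * E₁ - E₀ - E₀ := by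
          nth_rw 2 [← hsym]
          rw [hE₀, hE₁, ← integral_const_mul, ← integral_sub' (hi₁.const_mul _) hi₀,
            ← integral_sub' ((hi₁.const_mul _).sub hi₀) hij]
          exact integral_congr_ae (Filter.Eventually.of_forall fun x => by
            simp only [Pi.sub_apply]; ring)
        rw [this]; ring
      · intro x
        simp only [Function.comp, Equiv.swap_apply_left]
        rw [prod_comp_swap_succ hj]
        ring
  rw [hfirst, Finset.sum_congr rfl fun j _ => hterm j, Finset.sum_ite] at ibp
  have hcard : ((Finset.univ.filter fun j => j ∉ T).card : ℝ) = n - T.card := by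
    have := Finset.card_filter_add_card_filter_not (s := (Finset.univ : Finset (Fin n))) (· ∈ T)
    rw [Finset.filter_mem_eq_inter, Finset.univ_inter, Finset.card_univ, Fintype.card_fin] at this
    rw [eq_sub_iff_add_eq, add_comm]
    exact_mod_cast this
  rw [Finset.sum_const, Finset.sum_const, nsmul_eq_mul, nsmul_eq_mul, hcard,
    Finset.filter_mem_eq_inter, Finset.univ_inter] at ibp
  linear_combination (-2) * ibp

theorem integral_prod_mul_absVandermonde {L : ℝ} (hL : 0 ≤ L) {n : ℕ} (T : Finset (Fin n)) :
    ∫ x, (∏ i ∈ T, x i.succ) * absVandermonde x ∂cubeMeasure L (n + 1) =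
      (∏ k ∈ Finset.range T.card, L * (n - k + 2) / (2 * n - k + 4)) *
        ∫ x, absVandermonde x ∂cubeMeasure L (n + 1) := by
  induction T using Finset.induction_on with
  | empty => simp
  | insert a T ha ih =>
    have hrec := aomoto_recursion hL T
    have hT : (T.card : ℝ) ≤ n := by
      exact_mod_cast (Finset.card_le_univ T).trans_eq (Fintype.card_fin n)
    have hpos : (2 * n - T.card + 4 : ℝ) ≠ 0 := by
      have : (0 : ℝ) ≤ n := n.cast_nonneg
      linarith
    rw [integral_prod_mul_absVandermonde_insert ha, Finset.card_insert_of_notMem ha,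
      Finset.prod_range_succ, eq_div_of_mul_eq hpos hrec, ih]
    ring

/-- The recursion with `T` everything supplies the one remaining factor, `x 0`; the earlier factors
come from iterating over subsets of the other variables. -/
theorem integral_prod_univ_mul_absVandermonde {L : ℝ} (hL : 0 ≤ L) (n : ℕ) :
    ∫ x, (∏ i, x i) * absVandermonde x ∂cubeMeasure L n =
      (∏ k ∈ Finset.range n, L * (n - k + 1) / (2 * n - k + 2)) *
        ∫ x, absVandermonde x ∂cubeMeasure L n := by
  cases n with
  | zero => simp
  | succ n =>
    have hrec := aomoto_recursion hL (Finset.univ : Finset (Fin n))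
    have hpos : (2 * n - n + 4 : ℝ) ≠ 0 := by
      have : (0 : ℝ) ≤ n := n.cast_nonneg
      linarith
    simp only [Finset.card_univ, Fintype.card_fin] at hrec
    simp only [Fin.prod_univ_succ]
    rw [eq_div_of_mul_eq hpos hrec, integral_prod_mul_absVandermonde hL, Finset.prod_range_succ,
      Finset.card_univ, Fintype.card_fin]
    push_cast
    rw [Finset.prod_congr (g := fun k : ℕ => L * (n + 1 - k + 1) / (2 * (n + 1) - k + 2)) rfl
      fun k _ => by ring]
    ring

/-- Integrating by parts against `t - L` leaves only the boundary term at `0`, where `∏ |0 - y j|`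
is the product of the remaining variables. Each quotient term contributes half the integral, whence
`1 + n / 2`. -/
theorem integral_absVandermonde_succ {L : ℝ} (hL : 0 ≤ L) (n : ℕ) :
    (∫ x, absVandermonde x ∂cubeMeasure L (n + 1)) * (1 + n / 2) =
      L * ∫ x, (∏ i, x i) * absVandermonde x ∂cubeMeasure L n := by
  have ibp := integral_deriv_mul_absVandermonde hL (n := n) (φ := fun t => t - L)
    (φ' := fun _ => 1) (ψ := fun _ => 1) (fun t => (hasDerivAt_id t).sub_const L)
    (by fun_prop) (by fun_prop)
  have hterm : ∀ j : Fin n, ∫ x, (x 0 - L) * 1 * vandermondeQuot j x ∂cubeMeasure L (n + 1) =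
      (∫ x, absVandermonde x ∂cubeMeasure L (n + 1)) / 2 := by
    intro j
    rw [integral_mul_vandermondeQuot j (G := fun _ => 1) (by fun_prop)]
    · simp
    · intro x
      simp [Equiv.swap_apply_left]
  simp only [hterm, Finset.sum_const, Finset.card_univ, Fintype.card_fin, nsmul_eq_mul, one_mul]
    at ibp
  rw [← integral_const_mul]
  convert ibp using 1
  · ring
  · rw [cubeMeasure_eq_restrict]
    refine setIntegral_congr_fun (MeasurableSet.univ_pi fun _ => measurableSet_Icc) fun y hy => ?_
    have : ∏ j, |0 - y j| = ∏ j, y j :=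
      Finset.prod_congr rfl fun j _ => by rw [zero_sub, abs_neg, abs_of_nonneg (hy j trivial).1]
    simp only [this]
    ring

/-- A recursion for the integral of the absolute value of the Vandermonde determinant over
`[0, L]ⁿ`. -/
theorem integral_absVandermonde_recursion {L : ℝ} (hL : 0 ≤ L) (n : ℕ) :
    ∫ x, absVandermonde x ∂cubeMeasure L (n + 1) =
      2 * L / (n + 2) * (∏ k ∈ Finset.range n, L * (n - k + 1) / (2 * n - k + 2)) *
        ∫ x, absVandermonde x ∂cubeMeasure L n := by
  have h := integral_absVandermonde_succ hL n
  rw [integral_prod_univ_mul_absVandermonde hL] at h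
  have : (n + 2 : ℝ) ≠ 0 := by positivity
  field_simp
  linear_combination 2 * h

/-! ### Folding the cube onto increasing tuples -/

theorem volume_setOf_not_injective (n : ℕ) :
    volume {x : Fin n → ℝ | ¬Function.Injective x} = 0 := by
  have hsub : {x : Fin n → ℝ | ¬Function.Injective x} ⊆
      ⋃ p : {p : Fin n × Fin n // p.1 ≠ p.2},
        (LinearMap.ker (LinearMap.proj (R := ℝ) (φ := fun _ : Fin n => ℝ) p.1.1 -
          LinearMap.proj p.1.2) : Set (Fin n → ℝ)) := by
    intro x hx
    simp only [mem_ofPred_eq, Function.Injective, not_forall] at hx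
    obtain ⟨i, j, hij, hne⟩ := hx
    exact mem_iUnion.2 ⟨⟨(i, j), hne⟩, by simp [hij]⟩
  refine measure_mono_null hsub (measure_iUnion_null fun p => ?_)
  refine Measure.addHaar_submodule _ _ fun h => ?_
  have h1 : (Pi.single p.1.1 1 : Fin n → ℝ) ∈ LinearMap.ker
      (LinearMap.proj (R := ℝ) (φ := fun _ : Fin n => ℝ) p.1.1 - LinearMap.proj p.1.2) := by
    rw [h]; trivial
  simp [p.2.symm] at h1

theorem measurableSet_strictMono (n : ℕ) : MeasurableSet {x : Fin n → ℝ | StrictMono x} := by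
  have : {x : Fin n → ℝ | StrictMono x} = ⋂ i, ⋂ j, {x | i < j → x i < x j} := by
    ext x; simp [StrictMono]
  rw [this]
  refine MeasurableSet.iInter fun i => MeasurableSet.iInter fun j => ?_
  by_cases h : i < j
  · simpa [h] using measurableSet_lt (measurable_pi_apply i) (measurable_pi_apply j)
  · simp [h]

theorem Function.Injective.strictMono_comp_sort {n : ℕ} {x : Fin n → ℝ}
    (hx : Function.Injective x) : StrictMono (x ∘ Tuple.sort x) :=
  (Tuple.monotone_sort x).strictMono_of_injective (hx.comp (Tuple.sort x).injective)

/-- Exactly one permutation sorts an injective tuple. -/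
theorem sum_indicator_strictMono_comp_perm {n : ℕ} {g : (Fin n → ℝ) → ENNReal}
    (hg : ∀ (σ : Equiv.Perm (Fin n)) x, g (x ∘ σ) = g x) {x : Fin n → ℝ}
    (hx : Function.Injective x) :
    ∑ σ : Equiv.Perm (Fin n), {x : Fin n → ℝ | StrictMono x}.indicator g (x ∘ σ) = g x := by
  rw [Finset.sum_eq_single (Tuple.sort x)]
  · rw [indicator_of_mem (by exact hx.strictMono_comp_sort), hg]
  · intro σ _ hσ
    refine indicator_of_notMem (fun h => hσ ?_) g
    have h1 : x ∘ σ = x ∘ Tuple.sort x := by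
      rw [← StrictMono.range_inj h hx.strictMono_comp_sort]
      simp [Set.range_comp]
    exact Equiv.ext fun i => hx (congrFun h1 i)
  · simp

theorem lintegral_cubeMeasure_eq_factorial_mul (L : ℝ) {n : ℕ} {g : (Fin n → ℝ) → ENNReal}
    (hm : Measurable g) (hg : ∀ (σ : Equiv.Perm (Fin n)) x, g (x ∘ σ) = g x) :
    ∫⁻ x, g x ∂cubeMeasure L n =
      n.factorial * ∫⁻ x in {x | StrictMono x}, g x ∂cubeMeasure L n := by
  have hae : ∀ᵐ x ∂cubeMeasure L n, Function.Injective x := by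
    rw [cubeMeasure_eq_restrict]
    exact ae_restrict_of_ae (volume_setOf_not_injective n)
  rw [lintegral_congr_ae (hae.mono fun x hx => (sum_indicator_strictMono_comp_perm hg hx).symm),
    lintegral_finsetSum]
  · have hσ : ∀ σ : Equiv.Perm (Fin n),
        ∫⁻ x, {x : Fin n → ℝ | StrictMono x}.indicator g (x ∘ σ) ∂cubeMeasure L n =
          ∫⁻ x in {x | StrictMono x}, g x ∂cubeMeasure L n := fun σ => by
      rw [← lintegral_indicator (measurableSet_strictMono n)]
      exact (measurePreserving_comp_perm (volume.restrict (Icc (0 : ℝ) L)) σ).lintegral_comp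
        (hm.indicator (measurableSet_strictMono n))
    simp only [hσ, Finset.sum_const, Finset.card_univ, Fintype.card_perm, Fintype.card_fin,
      nsmul_eq_mul]
  · intro σ _
    exact (hm.indicator (measurableSet_strictMono n)).comp
      (measurable_pi_lambda _ fun i => measurable_pi_apply _)

/-! ### The map from roots to coordinates and its Jacobian -/

section RootMap

open Polynomial

/-- The monic polynomial whose roots are the `x i + c`. -/
noncomputable def shiftedRootPoly (c : ℝ) {n : ℕ} (x : Fin n → ℝ) : ℝ[X] :=
  ∏ j, (X - C (x j + c))

theorem shiftedRootPoly_monic (c : ℝ) {n : ℕ} (x : Fin n → ℝ) : (shiftedRootPoly c x).Monic :=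
  monic_prod_of_monic _ _ fun _ _ => monic_X_sub_C _

theorem shiftedRootPoly_natDegree (c : ℝ) {n : ℕ} (x : Fin n → ℝ) :
    (shiftedRootPoly c x).natDegree = n := by
  rw [shiftedRootPoly, natDegree_finsetProd_X_sub_C_eq_card, Finset.card_univ, Fintype.card_fin]

theorem shiftedRootPoly_comp_perm (c : ℝ) {n : ℕ} (σ : Equiv.Perm (Fin n)) (x : Fin n → ℝ) :
    shiftedRootPoly c (x ∘ σ) = shiftedRootPoly c x :=
  Equiv.prod_comp σ fun j => X - C (x j + c)

theorem mem_range_iff_shiftedRootPoly_eval (c : ℝ) {n : ℕ} (x : Fin n → ℝ) (t : ℝ) :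
    t ∈ range x ↔ (shiftedRootPoly c x).eval (t + c) = 0 := by
  simp only [shiftedRootPoly, eval_prod, eval_sub, eval_X, eval_C, add_sub_add_right_eq_sub]
  simp [Finset.prod_eq_zero_iff, sub_eq_zero, eq_comm (a := t)]

/-- The functional `ℓ` stays general because splitting off the factor `X - C (x a + c)` requires the
induction hypothesis for `p ↦ ℓ (X * p)` as well as for `ℓ`. -/
theorem hasFDerivAt_linear_prod_X_sub_C {ι : Type*} [Fintype ι] [DecidableEq ι] (c : ℝ)
    (s : Finset ι) (x : ι → ℝ) (ℓ : ℝ[X] →ₗ[ℝ] ℝ) :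
    HasFDerivAt (fun x : ι → ℝ => ℓ (∏ j ∈ s, (X - C (x j + c))))
      (∑ i ∈ s, (-ℓ (∏ j ∈ s.erase i, (X - C (x j + c)))) •
        (ContinuousLinearMap.proj i : (ι → ℝ) →L[ℝ] ℝ)) x := by
  induction s using Finset.induction_on generalizing ℓ with
  | empty => simpa using hasFDerivAt_const (ℓ 1) x
  | insert a s ha ih =>
    have h1 := ih (ℓ ∘ₗ LinearMap.mulLeft ℝ X)
    have hp : HasFDerivAt (fun x : ι → ℝ => x a + c)
        (ContinuousLinearMap.proj a : (ι → ℝ) →L[ℝ] ℝ) x :=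
      (ContinuousLinearMap.proj a : (ι → ℝ) →L[ℝ] ℝ).hasFDerivAt.add_const c
    have h2 := h1.sub (hp.mul (ih ℓ))
    have hsmul : ∀ (r : ℝ) (p : ℝ[X]), ℓ ((X - C r) * p) = ℓ (X * p) - r * ℓ p := fun r p => by
      rw [sub_mul, map_sub, C_mul', map_smul, smul_eq_mul]
    refine (h2.congr_fderiv ?_).congr_of_eventuallyEq (Filter.Eventually.of_forall fun y => ?_)
    · rw [Finset.sum_insert ha, Finset.erase_insert ha]
      have herase : ∀ i ∈ s, ℓ (∏ j ∈ (insert a s).erase i, (X - C (x j + c))) =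
          ℓ (X * ∏ j ∈ s.erase i, (X - C (x j + c))) -
            (x a + c) * ℓ (∏ j ∈ s.erase i, (X - C (x j + c))) := fun i hi => by
        have hai : a ≠ i := fun h => ha (h ▸ hi)
        rw [Finset.erase_insert_of_ne hai, Finset.prod_insert
          (fun h => ha (Finset.mem_of_mem_erase h)), hsmul]
      ext v
      simp only [_root_.sub_apply, _root_.add_apply,
        _root_.sum_apply, _root_.smul_apply,
        ContinuousLinearMap.proj_apply, smul_eq_mul, LinearMap.comp_apply,
        LinearMap.mulLeft_apply]
      have hsum : ∑ i ∈ s, -ℓ (∏ j ∈ (insert a s).erase i, (X - C (x j + c))) * v i =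
          ∑ i ∈ s, -ℓ (X * ∏ j ∈ s.erase i, (X - C (x j + c))) * v i -
            (x a + c) * ∑ i ∈ s, -ℓ (∏ j ∈ s.erase i, (X - C (x j + c))) * v i := by
        rw [Finset.mul_sum, ← Finset.sum_sub_distrib]
        exact Finset.sum_congr rfl fun i hi => by rw [herase i hi]; ring
      rw [hsum]
      ring
    · simp only [Finset.prod_insert ha, hsmul]
      simp

variable {S : Polynomial.Sequence ℝ} (hS : ∀ i, (S i).Monic)

/-- The basis of `ℝ[X]` given by a sequence of monic polynomials. -/
noncomputable def monicBasis : Module.Basis ℕ ℝ ℝ[X] :=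
  S.basis fun i => by rw [(hS i).leadingCoeff]; exact isUnit_one

theorem monicBasis_apply (i : ℕ) : monicBasis hS i = S i := by simp [monicBasis]

theorem sum_coord_monicBasis {n : ℕ} {p : ℝ[X]} (hp : p.degree < n) :
    ∑ i : Fin n, (monicBasis hS).coord (Fin.rev i : ℕ) p • S (Fin.rev i : ℕ) = p := by
  have h1 : p ∈ Submodule.span ℝ (monicBasis hS '' Set.Iio n) := by
    have : (monicBasis hS '' Set.Iio n) = S '' Set.Iio n := by
      simp only [funext (monicBasis_apply hS)]
    rw [this, S.span_degreeLT fun i _ => by rw [(hS i).leadingCoeff]; exact isUnit_one]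
    exact Polynomial.mem_degreeLT.2 hp
  rw [Module.Basis.mem_span_image] at h1
  have h2 : ((monicBasis hS).repr p).support ⊆ Finset.range n := fun i hi => by
    simpa using h1 hi
  refine (Equiv.sum_comp Fin.revPerm (fun i : Fin n => (monicBasis hS).coord (i : ℕ) p • S (i : ℕ))).trans ?_
  rw [Fin.sum_univ_eq_sum_range (fun i => (monicBasis hS).coord i p • S i)]
  conv_rhs => rw [← (monicBasis hS).linearCombination_repr p,
    Finsupp.linearCombination_apply, Finsupp.sum_of_support_subset _ h2 _ (by simp)]
  simp [monicBasis_apply]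

/-- The monic polynomial of degree `n` with lower coordinates `b` with respect to `S`, in order of
decreasing degree. -/
noncomputable def monicOfCoords (S : Polynomial.Sequence ℝ) {n : ℕ} (b : Fin n → ℝ) : ℝ[X] :=
  S n + ∑ i : Fin n, b i • S (Fin.rev i : ℕ)

/-- The coordinates with respect to `S` of the monic polynomial with roots `x i + c`. -/
noncomputable def rootCoords (c : ℝ) {n : ℕ} (x : Fin n → ℝ) : Fin n → ℝ := fun i =>
  (monicBasis hS).coord (Fin.rev i : ℕ) (shiftedRootPoly c x)

theorem coord_monicOfCoords {n : ℕ} (b : Fin n → ℝ) (i : Fin n) :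
    (monicBasis hS).coord (Fin.rev i : ℕ) (monicOfCoords S b) = b i := by
  have hn : n ≠ (Fin.rev i : ℕ) := (Fin.rev i).isLt.ne'
  have : ∀ k, S k = monicBasis hS k := fun k => (monicBasis_apply hS k).symm
  simp only [monicOfCoords, this, map_add, map_sum, map_smul, Module.Basis.coord_apply,
    Module.Basis.repr_self, smul_eq_mul, Finsupp.single_apply, if_neg hn, zero_add]
  rw [Finset.sum_eq_single i]
  · simp
  · intro j _ hj
    rw [if_neg, mul_zero]
    exact fun h => hj (Fin.rev_injective (Fin.ext h))
  · simp

theorem monicOfCoords_rootCoords (c : ℝ) {n : ℕ} (x : Fin n → ℝ) :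
    monicOfCoords S (rootCoords hS c x) = shiftedRootPoly c x := by
  have hdeg : (shiftedRootPoly c x - S n).degree < n := by
    have hx : (shiftedRootPoly c x).degree = n := by
      rw [degree_eq_natDegree (shiftedRootPoly_monic c x).ne_zero, shiftedRootPoly_natDegree]
    rw [← hx]
    refine degree_sub_lt_left (by rw [hx, S.degree_eq]) (shiftedRootPoly_monic c x).ne_zero ?_
    rw [(shiftedRootPoly_monic c x).leadingCoeff, (hS n).leadingCoeff]
  have h := sum_coord_monicBasis hS hdeg
  have hn : ∀ i : Fin n, (monicBasis hS).coord (Fin.rev i : ℕ) (S n) = 0 := fun i => by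
    have hn : n ≠ (Fin.rev i : ℕ) := (Fin.rev i).isLt.ne'
    rw [← monicBasis_apply hS, Module.Basis.coord_apply, Module.Basis.repr_self,
      Finsupp.single_apply, if_neg hn]
  simp only [map_sub, hn, sub_zero] at h
  rw [monicOfCoords]
  simp only [rootCoords]
  rw [h]; ring

theorem rootCoords_eq_iff (c : ℝ) {n : ℕ} (x : Fin n → ℝ) (b : Fin n → ℝ) :
    rootCoords hS c x = b ↔ monicOfCoords S b = shiftedRootPoly c x := by
  constructor
  · rintro rfl; exact monicOfCoords_rootCoords hS c x
  · intro h
    ext i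
    rw [rootCoords, ← h, coord_monicOfCoords]

theorem rootCoords_comp_perm (c : ℝ) {n : ℕ} (σ : Equiv.Perm (Fin n)) (x : Fin n → ℝ) :
    rootCoords hS c (x ∘ σ) = rootCoords hS c x := by
  unfold rootCoords; rw [shiftedRootPoly_comp_perm]

/-- The coordinates determine the polynomial, hence its zero set, and an increasing tuple is
determined by its range. -/
theorem injOn_rootCoords (c : ℝ) (n : ℕ) :
    InjOn (rootCoords hS c) {x : Fin n → ℝ | StrictMono x} := by
  intro x hx y hy hxy
  have h : shiftedRootPoly c x = shiftedRootPoly c y := by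
    rw [← monicOfCoords_rootCoords hS, hxy, monicOfCoords_rootCoords]
  rw [← StrictMono.range_inj hx hy]
  ext t
  rw [mem_range_iff_shiftedRootPoly_eval c, mem_range_iff_shiftedRootPoly_eval c, h]

/-- The Jacobian matrix of `rootCoords`. -/
noncomputable def rootCoordsJacobian (c : ℝ) {n : ℕ} (x : Fin n → ℝ) :
    Matrix (Fin n) (Fin n) ℝ :=
  Matrix.of fun k i => -(monicBasis hS).coord (Fin.rev k : ℕ)
    (∏ j ∈ Finset.univ.erase i, (X - C (x j + c)))

theorem hasFDerivAt_rootCoords (c : ℝ) {n : ℕ} (x : Fin n → ℝ) :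
    HasFDerivAt (rootCoords hS c)
      (LinearMap.toContinuousLinearMap (Matrix.toLin' (rootCoordsJacobian hS c x))) x := by
  rw [hasFDerivAt_pi']
  intro k
  refine (hasFDerivAt_linear_prod_X_sub_C c Finset.univ x
    ((monicBasis hS).coord (Fin.rev k : ℕ))).congr_fderiv ?_
  ext v
  simp [rootCoordsJacobian, Matrix.mulVec, dotProduct]

theorem absVandermonde_mul_self {n : ℕ} (x : Fin n → ℝ) :
    absVandermonde x * absVandermonde x = |∏ i, ∏ j ∈ Finset.univ.erase i, (x i - x j)| := by
  have h := Finset.prod_prod_Ioi_mul_eq_prod_prod_off_diag (fun i j : Fin n => |x i - x j|)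
  simp only [Finset.prod_mul_distrib] at h
  simp only [absVandermonde, Matrix.det_vandermonde, Finset.abs_prod]
  calc _ = _ := by
        congr 1
        exact Finset.prod_congr rfl fun i _ => Finset.prod_congr rfl fun j _ => abs_sub_comm _ _
    _ = _ := h
    _ = _ := by
        refine Finset.prod_congr rfl fun i _ => Finset.prod_congr ?_ fun j _ => abs_sub_comm _ _
        ext j; simp

theorem absVandermonde_ne_zero {n : ℕ} {x : Fin n → ℝ} (hx : Function.Injective x) :
    absVandermonde x ≠ 0 :=
  abs_ne_zero.2 (Matrix.det_vandermonde_ne_zero_iff.2 hx)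

theorem absVandermonde_add_const {n : ℕ} (x : Fin n → ℝ) (c : ℝ) :
    absVandermonde (fun i => x i + c) = absVandermonde x := by
  simp [absVandermonde, Matrix.det_vandermonde_add]

/-- A monic sequence is a unitriangular change of basis from the monomials, and reversing the
columns changes only the sign. -/
theorem abs_det_eval_sequence {S : Polynomial.Sequence ℝ} (hS : ∀ i, (S i).Monic) {n : ℕ}
    (x : Fin n → ℝ) :
    |(Matrix.of fun a k : Fin n => (S (Fin.rev k : ℕ)).eval (x a)).det| = absVandermonde x := by
  rw [absVandermonde, Matrix.det_eval_matrixOfPolynomials_eq_det_vandermonde x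
    (fun i : Fin n => S i) (fun i => S.natDegree_eq i) (fun i => hS i)]
  have h : (Matrix.of fun a k : Fin n => (S (Fin.rev k : ℕ)).eval (x a)) =
      (Matrix.of fun a k : Fin n => (S (k : ℕ)).eval (x a)).submatrix id Fin.revPerm := by
    ext a k; simp
  rw [h, Matrix.det_permute', abs_mul]
  rcases Int.units_eq_one_or (Equiv.Perm.sign (Fin.revPerm (n := n))) with h | h <;> simp [h]

/-- Column `i` of the Jacobian holds the coordinates of `-∏_{j ≠ i} (X - (x j + c))`. Evaluating at
the roots gives a diagonal matrix with determinant `±Δ²`, while the evaluation matrix has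
determinant `±Δ`; cancel one `Δ ≠ 0`. -/
theorem abs_det_rootCoordsJacobian (c : ℝ) {n : ℕ} {x : Fin n → ℝ} (hx : Function.Injective x) :
    |(rootCoordsJacobian hS c x).det| = absVandermonde x := by
  have hmul : (Matrix.of fun a k : Fin n => (S (Fin.rev k : ℕ)).eval (x a + c)) *
      rootCoordsJacobian hS c x =
      Matrix.diagonal fun i => -∏ j ∈ Finset.univ.erase i, (x i - x j) := by
    ext a i
    have hdeg : (∏ j ∈ Finset.univ.erase i, (X - C (x j + c)) : ℝ[X]).degree < n := by
      rw [degree_eq_natDegree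
        (monic_prod_of_monic _ _ fun j _ => monic_X_sub_C (x j + c)).ne_zero,
        natDegree_finsetProd_X_sub_C_eq_card, Nat.cast_lt,
        Finset.card_erase_of_mem (Finset.mem_univ i), Finset.card_univ, Fintype.card_fin]
      have := i.pos
      omega
    have h := congrArg (eval (x a + c)) (sum_coord_monicBasis hS hdeg)
    simp only [eval_finsetSum, eval_smul, smul_eq_mul] at h
    rw [Matrix.mul_apply, Matrix.diagonal_apply]
    simp only [rootCoordsJacobian, Matrix.of_apply, mul_neg, Finset.sum_neg_distrib]
    simp only [mul_comm (eval _ _)]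
    rw [h, eval_prod]
    split_ifs with hai
    · simp [hai]
    · rw [Finset.prod_eq_zero (i := a) (by simp [hai]) (by simp), neg_zero]
  have hdet := congrArg (fun A => |Matrix.det A|) hmul
  simp only [Matrix.det_mul, Matrix.det_diagonal, abs_mul] at hdet
  rw [abs_det_eval_sequence hS fun a => x a + c, absVandermonde_add_const] at hdet
  refine mul_left_cancel₀ (absVandermonde_ne_zero hx) (hdet.trans ?_)
  rw [absVandermonde_mul_self, Finset.abs_prod, Finset.abs_prod]
  simp only [abs_neg]

theorem continuous_rootCoords (c : ℝ) (n : ℕ) :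
    Continuous (rootCoords hS c : (Fin n → ℝ) → Fin n → ℝ) :=
  continuous_iff_continuousAt.2 fun x => (hasFDerivAt_rootCoords hS c x).continuousAt

/-- Tuples with repeated entries form a null set with null image, and sorting does not change the
coordinates, so increasing tuples already fill the image up to measure zero. Change variables there,
then unfold by symmetry at the cost of `n!`. -/
theorem volume_image_rootCoords (c L : ℝ) (n : ℕ) :
    volume (rootCoords hS c '' Set.pi univ fun _ : Fin n => Icc 0 L) =
      ENNReal.ofReal ((∫ x, absVandermonde x ∂cubeMeasure L n) / n.factorial) := by
  set K : Set (Fin n → ℝ) := Set.pi univ fun _ => Icc 0 L with hK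
  have hKm : MeasurableSet K := MeasurableSet.univ_pi fun _ => measurableSet_Icc
  have hsub : rootCoords hS c '' K ⊆ rootCoords hS c '' ({x | StrictMono x} ∩ K) ∪
      rootCoords hS c '' {x | ¬Function.Injective x} := by
    rintro _ ⟨x, hx, rfl⟩
    by_cases hi : Function.Injective x
    · exact Or.inl ⟨x ∘ Tuple.sort x, ⟨hi.strictMono_comp_sort, fun i _ => hx _ trivial⟩,
        rootCoords_comp_perm hS c _ x⟩
    · exact Or.inr ⟨x, hi, rfl⟩
  have hnull : volume (rootCoords hS c '' {x : Fin n → ℝ | ¬Function.Injective x}) = 0 :=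
    addHaar_image_eq_zero_of_differentiableOn_of_addHaar_eq_zero volume
      (fun x _ => (hasFDerivAt_rootCoords hS c x).differentiableAt.differentiableWithinAt)
      (volume_setOf_not_injective n)
  have hvol : volume (rootCoords hS c '' K) =
      volume (rootCoords hS c '' ({x | StrictMono x} ∩ K)) := by
    refine le_antisymm ((measure_mono hsub).trans ((measure_union_le _ _).trans ?_))
      (measure_mono (image_mono inter_subset_right))
    rw [hnull, add_zero]
  have hm : Measurable fun x : Fin n → ℝ => ENNReal.ofReal (absVandermonde x) :=
    continuous_absVandermonde.measurable.ennreal_ofReal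
  have hfac := lintegral_cubeMeasure_eq_factorial_mul L hm
    fun σ x => by rw [absVandermonde_comp_perm]
  have hn0 : (n.factorial : ENNReal) ≠ 0 := by exact_mod_cast n.factorial_ne_zero
  have hpos : (0 : ℝ) < n.factorial := by exact_mod_cast n.factorial_pos
  rw [hvol, ← lintegral_abs_det_fderiv_eq_addHaar_image volume
    ((measurableSet_strictMono n).inter hKm)
    (fun x _ => (hasFDerivAt_rootCoords hS c x).hasFDerivWithinAt)
    ((injOn_rootCoords hS c n).mono inter_subset_left),
    ENNReal.ofReal_div_of_pos hpos, ofReal_integral_eq_lintegral_ofReal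
      continuous_absVandermonde.integrable_cubeMeasure
      (Filter.Eventually.of_forall absVandermonde_nonneg), hfac, ENNReal.ofReal_natCast,
    mul_comm, ENNReal.mul_div_cancel_right hn0 (ENNReal.natCast_ne_top _),
    cubeMeasure_eq_restrict, Measure.restrict_restrict (measurableSet_strictMono n)]
  refine setLIntegral_congr_fun ((measurableSet_strictMono n).inter hKm) fun x hx => ?_
  have hdet : (LinearMap.toContinuousLinearMap
      (Matrix.toLin' (rootCoordsJacobian hS c x))).det = (rootCoordsJacobian hS c x).det := by
    simp [ContinuousLinearMap.det]
  simp only [hdet]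
  rw [abs_det_rootCoordsJacobian hS c (StrictMono.injective hx.1)]

end RootMap

/-! ### Chebyshev coordinates and the unit circle -/

section ChebyshevCoords

open Polynomial

theorem chebyshevC_succ_monic_and_natDegree (k : ℕ) :
    (Chebyshev.C ℝ ((k + 1 : ℕ) : ℤ)).Monic ∧
      (Chebyshev.C ℝ ((k + 1 : ℕ) : ℤ)).natDegree = k + 1 := by
  induction k using Nat.twoStepInduction with
  | zero => simp [Chebyshev.C_one, monic_X]
  | one =>
    have h : Chebyshev.C ℝ ((1 + 1 : ℕ) : ℤ) = X ^ 2 - C 2 := by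
      norm_num [Chebyshev.C_two]
      rfl
    rw [h]
    exact ⟨monic_X_pow_sub_C 2 two_ne_zero, natDegree_X_pow_sub_C⟩
  | more k h1 h2 =>
    have h : Chebyshev.C ℝ ((k + 2 + 1 : ℕ) : ℤ) =
        X * Chebyshev.C ℝ ((k + 1 + 1 : ℕ) : ℤ) - Chebyshev.C ℝ ((k + 1 : ℕ) : ℤ) := by
      have := Chebyshev.C_add_two ℝ ((k + 1 : ℕ) : ℤ)
      push_cast at this ⊢
      convert this using 2
      ring_nf
    have hm := monic_X.mul h2.1
    have hd : (X * Chebyshev.C ℝ ((k + 1 + 1 : ℕ) : ℤ)).natDegree = k + 2 + 1 := by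
      rw [monic_X.natDegree_mul h2.1, natDegree_X, h2.2]; ring
    have hlt : (Chebyshev.C ℝ ((k + 1 : ℕ) : ℤ)).natDegree <
        (X * Chebyshev.C ℝ ((k + 1 + 1 : ℕ) : ℤ)).natDegree := by
      rw [hd, h1.2]; omega
    rw [h]
    exact ⟨hm.sub_of_left (degree_lt_degree hlt),
      (natDegree_sub_eq_left_of_natDegree_lt hlt).trans hd⟩

theorem chebyshevC_eval_add_inv {z : ℂ} (hz : z ≠ 0) (k : ℕ) :
    (Chebyshev.C ℂ (k : ℤ)).eval (z + z⁻¹) = z ^ k + z⁻¹ ^ k := by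
  induction k using Nat.twoStepInduction with
  | zero => norm_num
  | one => simp
  | more k h1 h2 =>
    push_cast at h2 ⊢
    rw [Chebyshev.C_add_two, eval_sub, eval_mul, eval_X, h1, h2]
    have : z * z⁻¹ = 1 := mul_inv_cancel₀ hz
    linear_combination (z ^ k + z⁻¹ ^ k) * this

/-- The sequence `1, C₁, C₂, …` with `Cₖ (z + z⁻¹) = z ^ k + z⁻¹ ^ k`. -/
noncomputable def chebyshevSequence : Polynomial.Sequence ℝ where
  -- `Chebyshev.C ℝ 0` is 2, which is not monic; 1 also matches the unpaired middle term `b_n x^n`.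
  elems' k := if k = 0 then 1 else Chebyshev.C ℝ (k : ℤ)
  degree_eq' k := by
    cases k with
    | zero => simp
    | succ k =>
      have h := chebyshevC_succ_monic_and_natDegree k
      rw [if_neg k.succ_ne_zero, degree_eq_natDegree h.1.ne_zero, h.2]

theorem chebyshevSequence_apply (k : ℕ) :
    chebyshevSequence k = if k = 0 then 1 else Chebyshev.C ℝ (k : ℤ) := rfl

theorem chebyshevSequence_monic (k : ℕ) : (chebyshevSequence k).Monic := by
  cases k with
  | zero => simp [chebyshevSequence_apply]
  | succ k =>
    rw [chebyshevSequence_apply, if_neg k.succ_ne_zero]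
    exact (chebyshevC_succ_monic_and_natDegree k).1

theorem aeval_chebyshevSequence_add_inv {z : ℂ} (hz : z ≠ 0) {k : ℕ} (hk : k ≠ 0) :
    aeval (z + z⁻¹) (chebyshevSequence k) = z ^ k + z⁻¹ ^ k := by
  rw [chebyshevSequence_apply, if_neg hk, Chebyshev.aeval_C, chebyshevC_eval_add_inv hz]

theorem aeval_palindromicPoly {n : ℕ} (hn : n ≠ 0) (b : Fin n → ℝ) {z : ℂ} (hz : z ≠ 0) :
    aeval z (palindromicPoly n b) =
      z ^ n * aeval (z + z⁻¹) (monicOfCoords chebyshevSequence b) := by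
  have hinv : z * z⁻¹ = 1 := mul_inv_cancel₀ hz
  have hpow : ∀ k l, z ^ (k + l) * (z⁻¹) ^ l = z ^ k := fun k l => by
    rw [pow_add, mul_assoc, ← mul_pow, hinv, one_pow, mul_one]
  simp only [palindromicPoly, monicOfCoords, map_add, map_sum, map_pow, aeval_X, map_one, map_smul]
  rw [aeval_chebyshevSequence_add_inv hz hn, mul_add, Finset.mul_sum]
  congr 1
  · have := hpow 0 n
    rw [zero_add, pow_zero] at this
    rw [mul_add, this, two_mul, pow_add]
  · refine Finset.sum_congr rfl fun i _ => ?_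
    have hi := i.isLt
    split_ifs with h
    · have hr : ((Fin.rev i : Fin n) : ℕ) = 0 := by rw [Fin.val_rev]; omega
      rw [hr, chebyshevSequence_apply, if_pos rfl, map_mul, aeval_C, map_pow, aeval_X, map_one,
        Complex.real_smul, mul_one, Complex.coe_algebraMap, mul_comm]
    · obtain ⟨k, hk⟩ : ∃ k, ((Fin.rev i : Fin n) : ℕ) = k := ⟨_, rfl⟩
      have hk' : n = (i + 1) + k := by rw [← hk, Fin.val_rev]; omega
      have h1 : 2 * n - ((i : ℕ) + 1) = n + k := by omega
      rw [hk, aeval_chebyshevSequence_add_inv hz (by omega), h1]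
      have h2 := hpow (i + 1) k
      rw [← hk'] at h2
      simp only [map_mul, map_add, map_pow, aeval_X, aeval_C, Complex.real_smul,
        Complex.coe_algebraMap]
      rw [← h2, pow_add]
      ring

/-- `z` is a root of `X² - tX + 1`, whose discriminant is at most 0. A nonreal root has real part `t
/ 2`, and the real part of the equation then gives norm 1; a real root must be the double root `t /
2 = ±1`. -/
theorem norm_eq_one_of_add_inv {z : ℂ} (hz : z ≠ 0) {t : ℝ} (ht : t ∈ Icc (-2) 2)
    (h : z + z⁻¹ = t) : ‖z‖ = 1 := by
  have h1 : z * z + 1 = t * z := by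
    rw [← h, add_mul, inv_mul_cancel₀ hz]
  have hre := congrArg Complex.re h1
  have him := congrArg Complex.im h1
  simp only [Complex.add_re, Complex.mul_re, Complex.one_re, Complex.ofReal_re, Complex.ofReal_im,
    Complex.add_im, Complex.mul_im, Complex.one_im, zero_mul, sub_zero, add_zero] at hre him
  have hsq : z.re * z.re + z.im * z.im = 1 := by
    rcases eq_or_ne z.im 0 with hi | hi
    · rw [hi] at hre ⊢
      have h4 : t * t ≤ 4 := by nlinarith [ht.1, ht.2]
      have : z.re = t / 2 := by
        have : (z.re - t / 2) ^ 2 = 0 := by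
          nlinarith [sq_nonneg (z.re - t / 2)]
        linarith [pow_eq_zero_iff (two_ne_zero) |>.1 this]
      rw [this] at hre ⊢
      nlinarith
    · have : t = 2 * z.re := mul_right_cancel₀ hi (by linarith)
      rw [this] at hre
      linarith
  rw [← sq_eq_sq₀ (norm_nonneg z) zero_le_one, Complex.sq_norm, Complex.normSq_apply, hsq, one_pow]

theorem exists_shiftedRootPoly_eq {n : ℕ} {p : ℝ[X]} (hp : p.Monic) (hn : p.natDegree = n)
    (c : ℝ) {s : Set ℝ} (hs : ∀ w : ℂ, aeval w p = 0 → ∃ t ∈ s, w = ((t + c : ℝ) : ℂ)) :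
    ∃ x : Fin n → ℝ, (∀ i, x i ∈ s) ∧ p = shiftedRootPoly c x := by
  have hsplit := IsAlgClosed.splits (p.map (algebraMap ℝ ℂ))
  have hcard : (p.map (algebraMap ℝ ℂ)).roots.card = n := by
    rw [← hsplit.natDegree_eq_card_roots, natDegree_map, hn]
  obtain ⟨l, hl⟩ := Quot.exists_rep (p.map (algebraMap ℝ ℂ)).roots
  change (l : Multiset ℂ) = _ at hl
  have hlen : l.length = n := by rw [← hcard, ← hl]; rfl
  have hroot : ∀ w ∈ l, ∃ t ∈ s, w = ((t + c : ℝ) : ℂ) := fun w hw => by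
    refine hs w ?_
    have : w ∈ (p.map (algebraMap ℝ ℂ)).roots := by rw [← hl]; exact hw
    have := (mem_roots'.1 this).2
    rwa [IsRoot.def, eval_map_algebraMap] at this
  subst hlen
  choose x hx hxl using fun i : Fin l.length => hroot (l.get i) (l.get_mem i)
  refine ⟨x, hx, map_injective (algebraMap ℝ ℂ) (algebraMap ℝ ℂ).injective ?_⟩
  rw [hsplit.eq_prod_roots_of_monic (hp.map _), ← hl, shiftedRootPoly, Polynomial.map_prod]
  simp only [Multiset.map_coe, Multiset.prod_coe, Polynomial.map_sub, map_X, map_C]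
  rw [← List.prod_ofFn]
  congr 1
  apply List.ext_get
  · simp
  · intro i h1 h2
    have := hxl ⟨i, by simpa using h1⟩
    simp only [List.get_eq_getElem] at this
    simp [this]

theorem monicOfCoords_monic_and_natDegree {S : Polynomial.Sequence ℝ} (hS : ∀ i, (S i).Monic)
    {n : ℕ} (b : Fin n → ℝ) :
    (monicOfCoords S b).Monic ∧ (monicOfCoords S b).natDegree = n := by
  have hlt : (∑ i : Fin n, b i • S (Fin.rev i : ℕ)).degree < (S n).degree := by
    rw [S.degree_eq, ← Polynomial.mem_degreeLT]
    refine Submodule.sum_mem _ fun i _ => Submodule.smul_mem _ _ ?_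
    rw [Polynomial.mem_degreeLT, S.degree_eq, Nat.cast_lt]
    exact (Fin.rev i).isLt
  refine ⟨(hS n).add_of_left hlt, ?_⟩
  rw [monicOfCoords, natDegree_add_eq_left_of_degree_lt hlt, S.natDegree_eq]

/-- The map `z ↦ z + z⁻¹` sends nonzero complex numbers onto `ℂ`, and the preimage of `[-2, 2]` is
exactly the unit circle. -/
theorem unitCircleRegion_eq_image {n : ℕ} (hn : n ≠ 0) :
    unitCircleRegion n =
      rootCoords chebyshevSequence_monic (-2) '' Set.pi univ fun _ : Fin n => Icc 0 4 := by
  ext b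
  simp only [mem_image, rootCoords_eq_iff]
  constructor
  · intro hb
    obtain ⟨hm, hd⟩ := monicOfCoords_monic_and_natDegree chebyshevSequence_monic b
    obtain ⟨x, hx, hxb⟩ := exists_shiftedRootPoly_eq hm hd (-2) (s := Icc 0 4) fun w hw => by
      obtain ⟨z, hz⟩ := IsAlgClosed.exists_root (X ^ 2 - C w * X + 1 : ℂ[X]) (by
        have : (X ^ 2 - C w * X + 1 : ℂ[X]).degree = 2 := by compute_degree!
        rw [this]; norm_num)
      simp only [IsRoot.def, eval_add, eval_sub, eval_pow, eval_X, eval_mul, eval_C,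
        eval_one] at hz
      have hz0 : z ≠ 0 := by rintro rfl; simp at hz
      have hw' : w = z + z⁻¹ := by
        field_simp; linear_combination -hz
      have hnorm : ‖z‖ = 1 := hb z (by
        rw [aeval_palindromicPoly hn b hz0, ← hw', hw, mul_zero])
      have hre := abs_le.1 ((Complex.abs_re_le_norm z).trans hnorm.le)
      -- On the unit circle `z⁻¹` is the conjugate of `z`, so `w = 2 * z.re`; adding 2 undoes the
      -- shift `c = -2`.
      refine ⟨2 * z.re + 2, ⟨by linarith [hre.1], by linarith [hre.2]⟩, ?_⟩
      rw [hw', Complex.inv_eq_conj hnorm, Complex.add_conj]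
      push_cast; ring
    exact ⟨x, fun i _ => hx i, hxb⟩
  · rintro ⟨x, hx, hxb⟩ z hz
    have hz0 : z ≠ 0 := by
      rintro rfl
      -- Zero is never a root: the constant term of `g_b` is 1 when `n ≠ 0`.
      refine one_ne_zero (α := ℂ) ?_
      rw [← hz]
      simp only [palindromicPoly, map_add, map_sum, map_pow, aeval_X, map_one]
      rw [zero_pow (by omega), zero_add, Finset.sum_eq_zero, add_zero]
      intro i _
      have hi := i.isLt
      split_ifs
      · simp [hn]
      · have : 2 * n - ((i : ℕ) + 1) ≠ 0 := by omega
        simp [this]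
    rw [aeval_palindromicPoly hn b hz0, hxb, shiftedRootPoly, map_prod] at hz
    obtain ⟨i, -, hi⟩ := Finset.prod_eq_zero_iff.1
      ((mul_eq_zero.1 hz).resolve_left (pow_ne_zero _ hz0))
    rw [map_sub, aeval_X, aeval_C, sub_eq_zero] at hi
    have hxi := hx i trivial
    exact norm_eq_one_of_add_inv hz0 (t := x i + -2)
      ⟨by linarith [hxi.1], by linarith [hxi.2]⟩ hi

end ChebyshevCoords

/-! ### Closed forms and the ratio of consecutive volumes -/

theorem prod_Ico_sub_div_add (n : ℕ) :
    ∏ i ∈ Finset.Ico 1 (n + 1), (((n + 1 : ℕ) : ℝ) - (i : ℝ)) / (((n + 1 : ℕ) : ℝ) + (i : ℝ)) =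
      n.factorial * (n + 1).factorial / (2 * n + 1).factorial := by
  rw [Finset.prod_div_distrib]
  have h1 : ∏ i ∈ Finset.Ico 1 (n + 1), (((n + 1 : ℕ) : ℝ) - (i : ℝ)) = n.factorial := by
    rw [Finset.prod_Ico_eq_prod_range, ← Finset.prod_range_reflect,
      ← Finset.prod_range_add_one_eq_factorial]
    push_cast
    refine Finset.prod_congr (by simp) fun i hi => ?_
    have hi' : i < n := by simpa using hi
    obtain ⟨k, rfl⟩ := Nat.exists_eq_add_of_lt hi'
    have : i + k + 1 - 1 - i = k := by omega
    rw [this]; push_cast; ring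
  have h2 : ∀ m : ℕ, (∏ i ∈ Finset.Ico 1 (m + 1), (((n + 1 : ℕ) : ℝ) + (i : ℝ))) *
      (n + 1).factorial = (n + 1 + m).factorial := by
    intro m
    induction m with
    | zero => simp
    | succ m ih =>
      rw [Finset.prod_Ico_succ_top (by omega), mul_right_comm, ih, ← add_assoc,
        Nat.factorial_succ (n + 1 + m)]
      push_cast; ring
  have h3 := h2 n
  rw [show n + 1 + n = 2 * n + 1 by ring] at h3
  have hne : ((n + 1).factorial : ℝ) ≠ 0 := by exact_mod_cast (n + 1).factorial_ne_zero
  rw [h1, eq_div_of_mul_eq hne h3]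
  field_simp

theorem prod_range_aomoto_ratio (n : ℕ) :
    ∏ k ∈ Finset.range n, (4 : ℝ) * ((n : ℝ) - k + 1) / (2 * n - k + 2) =
      4 ^ n * ((n + 1).factorial * (n + 2).factorial) / (2 * n + 2).factorial := by
  rw [Finset.prod_div_distrib, Finset.prod_mul_distrib, Finset.prod_const, Finset.card_range]
  have h1 : ∏ k ∈ Finset.range n, ((n : ℝ) - k + 1) = (n + 1).factorial := by
    rw [← Finset.prod_range_reflect, ← Finset.prod_range_add_one_eq_factorial,
      Finset.prod_range_succ']
    push_cast
    rw [mul_one]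
    refine Finset.prod_congr rfl fun i hi => ?_
    have hi' : i < n := by simpa using hi
    obtain ⟨k, rfl⟩ := Nat.exists_eq_add_of_lt hi'
    have : i + k + 1 - 1 - i = k := by omega
    rw [this]; push_cast; ring
  have h2 : (∏ k ∈ Finset.range n, (2 * (n : ℝ) - k + 2)) * (n + 2).factorial =
      (2 * n + 2).factorial := by
    have h := Nat.factorial_mul_descFactorial (n := 2 * n + 2) (k := n) (by omega)
    rw [show 2 * n + 2 - n = n + 2 by omega, Nat.descFactorial_eq_prod_range] at h
    rw [← h, mul_comm]
    push_cast
    congr 1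
    refine Finset.prod_congr rfl fun k hk => ?_
    have hk' : k < n := by simpa using hk
    rw [Nat.cast_sub (by omega)]
    push_cast; ring
  have hne : ((n + 2).factorial : ℝ) ≠ 0 := by exact_mod_cast (n + 2).factorial_ne_zero
  rw [h1, eq_div_of_mul_eq hne h2]
  field_simp

theorem prod_Icc_even_div_odd (n : ℕ) :
    ∏ j ∈ Finset.Icc 1 n, (2 * (j : ℝ) / (2 * (j : ℝ) - 1)) =
      4 ^ n * (n.factorial * n.factorial) / (2 * n).factorial := by
  induction n with
  | zero => simp
  | succ n ih =>
    rw [Finset.prod_Icc_succ_top (by omega), ih, show 2 * (n + 1) = 2 * n + 1 + 1 by ring,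
      Nat.factorial_succ (2 * n + 1), Nat.factorial_succ (2 * n), Nat.factorial_succ n]
    push_cast
    have h1 : (2 * ((n : ℝ) + 1) - 1) ≠ 0 := by
      have : (0 : ℝ) ≤ n := n.cast_nonneg
      linarith
    have h2 : (2 * (n : ℝ) + 1) ≠ 0 := by positivity
    have h3 : ((2 * n).factorial : ℝ) ≠ 0 := by exact_mod_cast (2 * n).factorial_ne_zero
    have h4 : (2 * (n : ℝ) + 1 + 1) ≠ 0 := by positivity
    field_simp
    ring

/-- The ratio of consecutive volumes. -/
noncomputable def volumeRatio (n : ℕ) : ℝ :=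
  4 ^ (n + 1) * (n.factorial * n.factorial) / (2 * n + 1).factorial

theorem volume_formula_succ (n : ℕ) :
    (2 : ℝ) ^ ((n + 1) * (n + 1 + 1)) / ((n + 1).factorial : ℝ) *
        ∏ j ∈ Finset.Icc 1 (n + 1), ∏ i ∈ Finset.Ico 1 j, ((j : ℝ) - (i : ℝ)) / ((j : ℝ) + (i : ℝ)) =
      volumeRatio n * ((2 : ℝ) ^ (n * (n + 1)) / (n.factorial : ℝ) *
        ∏ j ∈ Finset.Icc 1 n, ∏ i ∈ Finset.Ico 1 j, ((j : ℝ) - (i : ℝ)) / ((j : ℝ) + (i : ℝ))) := by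
  rw [Finset.prod_Icc_succ_top (by omega), prod_Ico_sub_div_add, volumeRatio, Nat.factorial_succ n,
    show (n + 1) * (n + 1 + 1) = n * (n + 1) + 2 * (n + 1) by ring, pow_add]
  push_cast
  have h1 : (n.factorial : ℝ) ≠ 0 := by exact_mod_cast n.factorial_ne_zero
  have h2 : ((n : ℝ) + 1) ≠ 0 := by positivity
  have h4 : (2 : ℝ) ^ (2 * (n + 1)) = 4 ^ (n + 1) := by rw [pow_mul]; norm_num
  rw [h4]
  generalize ∏ j ∈ Finset.Icc 1 n, ∏ i ∈ Finset.Ico 1 j,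
    ((j : ℝ) - (i : ℝ)) / ((j : ℝ) + (i : ℝ)) = P
  field_simp

theorem even_odd_formula_succ (n : ℕ) :
    (2 : ℝ) ^ (n + 1) / ((n + 1).factorial : ℝ) *
        ∏ j ∈ Finset.Icc 1 (n + 1), (2 * (j : ℝ) / (2 * (j : ℝ) - 1)) ^ (n + 1 + 1 - j) =
      volumeRatio n * ((2 : ℝ) ^ n / (n.factorial : ℝ) *
        ∏ j ∈ Finset.Icc 1 n, (2 * (j : ℝ) / (2 * (j : ℝ) - 1)) ^ (n + 1 - j)) := by
  -- Passing from `n` to `n + 1` raises every exponent by one, so the new contribution is a single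
  -- Wallis-type product.
  have h : ∏ j ∈ Finset.Icc 1 (n + 1), (2 * (j : ℝ) / (2 * (j : ℝ) - 1)) ^ (n + 1 + 1 - j) =
      (∏ j ∈ Finset.Icc 1 n, (2 * (j : ℝ) / (2 * (j : ℝ) - 1)) ^ (n + 1 - j)) *
        ∏ j ∈ Finset.Icc 1 (n + 1), (2 * (j : ℝ) / (2 * (j : ℝ) - 1)) := by
    rw [Finset.prod_Icc_succ_top (by omega), Finset.prod_Icc_succ_top (by omega), ← mul_assoc,
      ← Finset.prod_mul_distrib]
    congr 1
    · refine Finset.prod_congr rfl fun j hj => ?_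
      have := (Finset.mem_Icc.1 hj).2
      rw [← pow_succ]
      congr 1; omega
    · simp
  rw [h, prod_Icc_even_div_odd, volumeRatio, show 2 * (n + 1) = 2 * n + 1 + 1 by ring,
    Nat.factorial_succ (2 * n + 1), Nat.factorial_succ n]
  push_cast
  have h1 : (n.factorial : ℝ) ≠ 0 := by exact_mod_cast n.factorial_ne_zero
  have h2 : ((n : ℝ) + 1) ≠ 0 := by positivity
  have h3 : ((2 * n + 1).factorial : ℝ) ≠ 0 := by exact_mod_cast (2 * n + 1).factorial_ne_zero
  have h4 : (2 * (n : ℝ) + 1 + 1) ≠ 0 := by positivity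
  field_simp
  ring

theorem integral_absVandermonde_div_factorial_succ (n : ℕ) :
    (∫ x, absVandermonde x ∂cubeMeasure 4 (n + 1)) / (n + 1).factorial =
      volumeRatio n * ((∫ x, absVandermonde x ∂cubeMeasure 4 n) / n.factorial) := by
  rw [integral_absVandermonde_recursion (by norm_num), prod_range_aomoto_ratio, volumeRatio,
    Nat.factorial_succ (n + 1), Nat.factorial_succ n, Nat.factorial_succ (2 * n + 1)]
  push_cast
  have h1 : (n.factorial : ℝ) ≠ 0 := by exact_mod_cast n.factorial_ne_zero
  have h2 : ((n : ℝ) + 1) ≠ 0 := by positivity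
  have h3 : ((2 * n + 1).factorial : ℝ) ≠ 0 := by exact_mod_cast (2 * n + 1).factorial_ne_zero
  have h4 : (2 * (n : ℝ) + 1 + 1) ≠ 0 := by positivity
  have h5 : ((n : ℝ) + 2) ≠ 0 := by positivity
  field_simp
  ring

theorem integral_absVandermonde_div_factorial (n : ℕ) :
    (∫ x, absVandermonde x ∂cubeMeasure 4 n) / n.factorial =
      (2 : ℝ) ^ (n * (n + 1)) / (n.factorial : ℝ) *
        ∏ j ∈ Finset.Icc 1 n, ∏ i ∈ Finset.Ico 1 j, ((j : ℝ) - (i : ℝ)) / ((j : ℝ) + (i : ℝ)) := by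
  induction n with
  | zero => simp [absVandermonde, cubeMeasure, Measure.real]
  | succ n ih => rw [integral_absVandermonde_div_factorial_succ, ih, volume_formula_succ]

theorem volume_formula_eq_even_odd_formula (n : ℕ) :
    (2 : ℝ) ^ (n * (n + 1)) / (n.factorial : ℝ) *
        ∏ j ∈ Finset.Icc 1 n, ∏ i ∈ Finset.Ico 1 j, ((j : ℝ) - (i : ℝ)) / ((j : ℝ) + (i : ℝ)) =
      (2 : ℝ) ^ n / (n.factorial : ℝ) *
        ∏ j ∈ Finset.Icc 1 n, (2 * (j : ℝ) / (2 * (j : ℝ) - 1)) ^ (n + 1 - j) := by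
  induction n with
  | zero => simp
  | succ n ih => rw [volume_formula_succ, even_odd_formula_succ, ih]

/-! ### The degenerate case and the conclusion -/

theorem unitCircleRegion_zero : unitCircleRegion 0 = univ := by
  refine eq_univ_of_forall fun b z hz => ?_
  have h2 : palindromicPoly 0 b = Polynomial.C 2 := by
    simp [palindromicPoly, one_add_one_eq_two, Polynomial.C_ofNat]
  rw [h2, Polynomial.aeval_C] at hz
  norm_num at hz

theorem proposition2p2p1 (n : ℕ) :
    MeasurableSet (unitCircleRegion n) ∧
    MeasureTheory.volume (unitCircleRegion n) =
      ENNReal.ofReal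
        ((2 : ℝ) ^ (n * (n + 1)) / (n.factorial : ℝ) *
          ∏ j ∈ Finset.Icc 1 n, ∏ i ∈ Finset.Ico 1 j, ((j : ℝ) - (i : ℝ)) / ((j : ℝ) + (i : ℝ))) ∧
    (2 : ℝ) ^ (n * (n + 1)) / (n.factorial : ℝ) *
        ∏ j ∈ Finset.Icc 1 n, ∏ i ∈ Finset.Ico 1 j, ((j : ℝ) - (i : ℝ)) / ((j : ℝ) + (i : ℝ)) =
      (2 : ℝ) ^ n / (n.factorial : ℝ) *
        ∏ j ∈ Finset.Icc 1 n, (2 * (j : ℝ) / (2 * (j : ℝ) - 1)) ^ (n + 1 - j) := by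
  refine ⟨?_, ?_, volume_formula_eq_even_odd_formula n⟩
  · rcases eq_or_ne n 0 with rfl | hn
    · rw [unitCircleRegion_zero]; exact MeasurableSet.univ
    · rw [unitCircleRegion_eq_image hn]
      -- The region is a continuous image of a compact cube, hence compact.
      exact ((isCompact_univ_pi fun _ => isCompact_Icc).image
        (continuous_rootCoords chebyshevSequence_monic (-2) n)).measurableSet
  · rcases eq_or_ne n 0 with rfl | hn
    · rw [unitCircleRegion_zero]
      simp [volume_pi]
    · rw [unitCircleRegion_eq_image hn, volume_image_rootCoords,
        integral_absVandermonde_div_factorial]
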